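/- Let finitely many parties $i\in I$ share a multipartite quantum system, and let $\Psi$ and $\Phi$ be unit vectors (pure states) in $\bigotimes_{i}\mathbb C^{d_i}$ and $\bigotimes_{i}\mathbb C^{d_i'}$ respectively; a state is identified with its projector $|\Psi\rangle\langle\Psi|$. An LOCC protocol consists of finitely many steps, in each of which one party applies to its own subsystem a trace-preserving quantum instrument with finitely many outcomes (unitaries, adjoining ancillas, measurements, discarding subsystems; the dimension of the subsystem may change) and announces the outcome to the other parties, the later steps being allowed to depend on all earlier outcomes. The states $\Psi$ and $\Phi$ are exactly LOCC-equivalent if the trace-preserving superoperator of some LOCC protocol maps $|\Psi\rangle\langle\Psi|$ to $|\Phi\rangle\langle\Phi|$ and that of another maps $|\Phi\rangle\langle\Phi|$ to $|\Psi\rangle\langle\Psi|$. They are LU-equivalent if there are dimensions $D_i$ and isometries $V_i:\mathbb C^{d_i}\to\mathbb C^{D_i}$, $W_i:\mathbb C^{d_i'}\to\mathbb C^{D_i}$ such that $\bigotimes_i V_i\,\Psi$ and $\bigotimes_i W_i\,\Phi$ are the same state (i.e. equal up to a global phase). Then $\Psi$ and $\Phi$ are exactly LOCC-equivalent if and only if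 they are LU-equivalent. -/

import Mathlib

open scoped BigOperators Matrix

namespace MultiLOCC

/-- Computational-basis labels of a multipartite system in which party `i` holds `ℂ ^ (d i)`. -/
abbrev Conf {ι : Type*} (d : ι → ℕ) : Type _ := ∀ i, Fin (d i)

/-- The Hilbert space `⨂ i, ℂ ^ (d i)`, in coordinates with respect to the product basis. -/
abbrev Ket {ι : Type*} [Fintype ι] (d : ι → ℕ) : Type _ := EuclideanSpace ℂ (Conf d)

/-- Operators on `⨂ i, ℂ ^ (d i)`; density matrices live here. -/
abbrev Op {ι : Type*} (d : ι → ℕ) : Type _ := Matrix (Conf d) (Conf d) ℂ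

section Basic

variable {ι : Type*} [Fintype ι] [DecidableEq ι] {d d' : ι → ℕ}

/-- The projector `|ψ⟩⟨ψ|`. -/
noncomputable def proj (ψ : Ket d) : Op d :=
  Matrix.of fun x y => ψ x * star (ψ y)

/-- The tensor product `⨂ i, A i` of local operators `A i : ℂ ^ (d i) → ℂ ^ (d' i)`. -/
noncomputable def tensorOp (A : ∀ i, Matrix (Fin (d' i)) (Fin (d i)) ℂ) :
    Matrix (Conf d') (Conf d) ℂ :=
  Matrix.of fun x y => ∏ i, A i (x i) (y i)

/-- The completely positive map `ρ ↦ M ρ M†`. -/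
noncomputable def conjMap (M : Matrix (Conf d') (Conf d) ℂ) : Op d →ₗ[ℂ] Op d' where
  toFun ρ := M * ρ * Mᴴ
  map_add' ρ σ := by rw [Matrix.mul_add, Matrix.add_mul]
  map_smul' c ρ := by simp

/-- The family of local operators in which party `k` applies `A : ℂ ^ (d k) → ℂ ^ e` and every
other party applies the identity. -/
noncomputable def localFamily (k : ι) {e : ℕ} (A : Matrix (Fin e) (Fin (d k)) ℂ) (j : ι) :
    Matrix (Fin (Function.update d k e j)) (Fin (d j)) ℂ :=
  Matrix.of fun x y =>
    if h : j = k then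
      A (Fin.cast (by rw [h, Function.update_self]) x) (Fin.cast (by rw [h]) y)
    else if (x : ℕ) = (y : ℕ) then 1 else 0

end Basic

/-- A quantum instrument on `ℂ ^ n` with finitely many classical outcomes. On outcome `a` the
(unnormalised) state becomes `∑ s, K a s ρ (K a s)†` on `ℂ ^ (dim a)`; summed over the outcomes
the map preserves the trace. Unitaries, adjoining ancillas, measurements and discarding subsystems
are all of this form. -/
structure Instrument (n : ℕ) where
  /-- number of outcomes -/
  outcomes : ℕ
  /-- dimension of the output space, which may depend on the outcome -/
  dim : Fin outcomes → ℕ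
  /-- number of Kraus operators belonging to an outcome -/
  rank : Fin outcomes → ℕ
  /-- the Kraus operators -/
  kraus : ∀ a, Fin (rank a) → Matrix (Fin (dim a)) (Fin n) ℂ
  /-- trace preservation -/
  complete : ∑ a, ∑ s, (kraus a s)ᴴ * kraus a s = 1

/-- A (finite) LOCC protocol with output dimensions `d'`, started in dimensions `d`: either stop, or
let one party `k` apply an instrument to its own subsystem and announce the outcome `a` to all
parties, who then continue with a protocol that may depend on `a`. -/
inductive Protocol {ι : Type*} [DecidableEq ι] (d' : ι → ℕ) : (ι → ℕ) → Type _
  | done : Protocol d' d'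
  | step {d : ι → ℕ} (k : ι) (I : Instrument (d k))
      (next : ∀ a : Fin I.outcomes, Protocol d' (Function.update d k (I.dim a))) : Protocol d' d

section Equivalences

variable {ι : Type*} [Fintype ι] [DecidableEq ι] {d d' : ι → ℕ}

/-- The superoperator implemented by a protocol. -/
noncomputable def Protocol.superop : {d : ι → ℕ} → Protocol d' d → (Op d →ₗ[ℂ] Op d')
  | _, .done => LinearMap.id
  | _, .step k I next =>
      ∑ a, (next a).superop ∘ₗ ∑ s, conjMap (tensorOp (localFamily k (I.kraus a s)))

/-- `φ ≤ ψ`: some LOCC protocol transforms the pure state `ψ` exactly into the pure state `φ`. -/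
def ExactlyReducible (φ : Ket d') (ψ : Ket d) : Prop :=
  ∃ P : Protocol d' d, P.superop (proj ψ) = proj φ

/-- Exact LOCC equivalence. -/
def LOCCEquiv (ψ : Ket d) (φ : Ket d') : Prop :=
  ExactlyReducible φ ψ ∧ ExactlyReducible ψ φ

/-- Equivalence under local unitaries, the local dimensions being allowed to change: after local
isometric embeddings `V i`, `W i` into common spaces `ℂ ^ (D i)` the two states coincide. (A local
unitary of the common space is absorbed in `V i`.) -/
def LUEquiv (ψ : Ket d) (φ : Ket d') : Prop :=
  ∃ (D : ι → ℕ) (V : ∀ i, Matrix (Fin (D i)) (Fin (d i)) ℂ)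
    (W : ∀ i, Matrix (Fin (D i)) (Fin (d' i)) ℂ),
    (∀ i, (V i)ᴴ * V i = 1) ∧ (∀ i, (W i)ᴴ * W i = 1) ∧
      conjMap (tensorOp V) (proj ψ) = conjMap (tensorOp W) (proj φ)

end Equivalences

end MultiLOCC

/-!
Both directions go through a third relation: *local contractions* `A i`, i.e. `A i† A i ≤ 1`, with
`⨂ A i` mapping `|ψ⟩⟨ψ|` to `|φ⟩⟨φ|`.

**From LOCC equivalence to local contractions.** For each party `j`, the Hilbert–Schmidt norm
`redNorm j` of the reduced state of `j` (equal to that of the reduced state of all other parties)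
does not decrease on average under LOCC: in a step of party `k`, the reduced state of `j ≠ k` before
the step is the sum of those after the outcomes, and so is the reduced state of the complement of
`k`; the triangle inequality does the rest (`redNorm_le_sum`). Since the final state is pure, hence
extremal (`eq_smul_proj_of_sum_eq`), each single branch of a protocol from `ψ` to `φ` ends in a
multiple of `φ`. If conversions exist in both directions, all these inequalities are equalities.
Strict convexity of the norm then forces every branch of a step of `k` to leave the reduced state
of the other parties unchanged up to its trace, so that the state after the step is a purification
of the reduced state before it and is reached by a contraction of party `k`
(`exists_contraction_of_redNorm_eq`). Composing the contractions along one branch gives the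
conversion (`redNorm_le_and_exists_contraction`). The Hilbert–Schmidt norm plays the role usually
given to the entropy of entanglement, and makes spectral arguments unnecessary.

**Local contractions and local isometries.** A contraction `A` dilates to isometries `V`, `W` with
`W† V = A` (`IsContraction.exists_dilation`), and as no norm is lost in mapping `ψ` to `φ`, the
dilated states coincide (`luEquiv_of_contraction`). Conversely `W i† V i` is a contraction.

**From local contractions to LOCC.** Each party completes its contraction to a trace-preserving
instrument with a single outcome. The resulting channel dominates the map `ρ ↦ (⨂ A i) ρ (⨂ A i)†`
(`exists_protocol_dominating`) and both have the same trace on `|ψ⟩⟨ψ|`, so they agree there.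
-/

namespace MultiLOCC

open scoped ComplexOrder

/-! ### Contractions, range projections and the Hilbert–Schmidt norm -/

section MatrixLemmas

variable {m n p : Type*} [Fintype m] [Fintype n]

/-- A matrix `A` is a contraction if `A† A ≤ 1` in the Loewner order. -/
def IsContraction [DecidableEq n] (A : Matrix m n ℂ) : Prop :=
  (1 - Aᴴ * A).PosSemidef

omit [Fintype n] in
theorem IsContraction.of_isometry [DecidableEq n] {A : Matrix m n ℂ} (h : Aᴴ * A = 1) :
    IsContraction A := by
  rw [IsContraction, h, sub_self]
  exact Matrix.PosSemidef.zero

theorem IsContraction.mul [Fintype p] [DecidableEq m] [DecidableEq n]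
    {B : Matrix p m ℂ} {A : Matrix m n ℂ} (hB : IsContraction B)
    (hA : IsContraction A) : IsContraction (B * A) := by
  have h := hA.add (hB.conjTranspose_mul_mul_same A)
  have e : 1 - Aᴴ * A + Aᴴ * (1 - Bᴴ * B) * A = 1 - (B * A)ᴴ * (B * A) := by
    simp only [Matrix.mul_sub, Matrix.sub_mul, Matrix.conjTranspose_mul, Matrix.mul_assoc,
      Matrix.mul_one]
    abel
  rwa [e] at h

/-- `1 - V† W W† V = ((1 - W W†) V)† (1 - W W†) V` is positive. -/
theorem IsContraction.conjTranspose_mul [Fintype p] [DecidableEq m] [DecidableEq n]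
    {W : Matrix p m ℂ} {V : Matrix p n ℂ} (hW : Wᴴ * W = 1) (hV : Vᴴ * V = 1) :
    IsContraction (Wᴴ * V) := by
  have h : ((V - W * (Wᴴ * V))ᴴ * (V - W * (Wᴴ * V))).PosSemidef :=
    Matrix.posSemidef_conjTranspose_mul_self _
  have e : (V - W * (Wᴴ * V))ᴴ * (V - W * (Wᴴ * V)) = 1 - (Wᴴ * V)ᴴ * (Wᴴ * V) := by
    have : Wᴴ * (W * (Wᴴ * V)) = Wᴴ * V := by rw [← Matrix.mul_assoc, hW, Matrix.one_mul]
    simp only [Matrix.mul_sub, Matrix.sub_mul, Matrix.conjTranspose_mul, Matrix.mul_assoc,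
      Matrix.conjTranspose_sub, Matrix.conjTranspose_conjTranspose, this, hV]
    abel
  rwa [e] at h

theorem exists_conjTranspose_mul_self {M : Matrix m m ℂ} (hM : M.PosSemidef) :
    ∃ B : Matrix m m ℂ, Bᴴ * B = M := by
  classical
  open scoped MatrixOrder in
  obtain ⟨X, hX, -, h⟩ :=
    CFC.exists_sqrt_of_isSelfAdjoint_of_quasispectrumRestricts hM.isHermitian
      (QuasispectrumRestricts.nnreal_of_nonneg hM.nonneg)
  exact ⟨X, by rw [← h, ← Matrix.star_eq_conjTranspose, hX.star_eq]⟩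

/-- The orthogonal projection onto the column space of `M` has the form `M * X`. -/
theorem exists_range_projection [DecidableEq m] (M : Matrix m n ℂ) :
    ∃ X : Matrix n m ℂ, (M * X)ᴴ * (M * X) = M * X ∧ M * X * M = M := by
  -- `X` solves the normal equations `M† M X = M†`.
  have hr : LinearMap.range (Mᴴ * M).mulVecLin = LinearMap.range Mᴴ.mulVecLin := by
    apply Submodule.eq_of_le_of_finrank_eq
    · rw [Matrix.mulVecLin_mul]
      exact LinearMap.range_comp_le_range _ _
    · change (Mᴴ * M).rank = Mᴴ.rank
      rw [Matrix.rank_conjTranspose_mul_self, Matrix.rank_conjTranspose]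
  have hx : ∀ j : m, ∃ x : n → ℂ, (Mᴴ * M) *ᵥ x = Mᴴ *ᵥ Pi.single j 1 := by
    intro j
    have : Mᴴ *ᵥ Pi.single j 1 ∈ LinearMap.range (Mᴴ * M).mulVecLin := by
      rw [hr]; exact ⟨_, rfl⟩
    exact this
  choose x hx using hx
  have hX : Mᴴ * (M * Matrix.of fun i j => x j i) = Mᴴ := by
    ext i j
    have h := congrFun (hx j) i
    rw [Matrix.mulVec_single_one] at h
    rw [← Matrix.mul_assoc]
    exact h
  generalize (Matrix.of fun i j => x j i) = X at hX
  have h1 : (M * X)ᴴ * M = M := by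
    have := congrArg Matrix.conjTranspose hX
    simpa using this
  have h2 : (M * X)ᴴ * (M * X) = M * X := by rw [← Matrix.mul_assoc, h1]
  have h3 : (M * X)ᴴ = M * X := by
    have := congrArg Matrix.conjTranspose h2
    rw [Matrix.conjTranspose_mul, Matrix.conjTranspose_conjTranspose, h2] at this
    exact this.symm
  exact ⟨X, h2, by rw [← h3, h1]⟩

/-- If `K` acts on the column space of `M` as `√l` times an isometry, then on that space it agrees
up to this factor with a contraction. -/
theorem exists_contraction_mul_eq [Fintype p] [DecidableEq m]
    {M : Matrix m n ℂ} {K : Matrix p m ℂ} {l : ℝ} (hl : 0 < l)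
    (h : Mᴴ * (Kᴴ * K) * M = (l : ℂ) • (Mᴴ * M)) :
    ∃ A : Matrix p m ℂ, IsContraction A ∧ A * M = ((√l)⁻¹ : ℂ) • (K * M) := by
  obtain ⟨X, hX, hXM⟩ := exists_range_projection M
  have hl' : (l : ℂ) ≠ 0 := by exact_mod_cast hl.ne'
  have hs : ((√l)⁻¹ : ℂ) * ((√l)⁻¹ : ℂ) = (l : ℂ)⁻¹ := by
    rw [← mul_inv]; congr 1; exact_mod_cast Real.mul_self_sqrt hl.le
  have hst : star ((√l)⁻¹ : ℂ) = ((√l)⁻¹ : ℂ) := by simp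
  have hPh : (M * X)ᴴ = M * X := by
    have := congrArg Matrix.conjTranspose hX
    rw [Matrix.conjTranspose_mul, Matrix.conjTranspose_conjTranspose, hX] at this
    exact this.symm
  refine ⟨((√l)⁻¹ : ℂ) • (K * (M * X)), ?_, ?_⟩
  · have e : (((√l)⁻¹ : ℂ) • (K * (M * X)))ᴴ * (((√l)⁻¹ : ℂ) • (K * (M * X))) = M * X := by
      calc _ = (l : ℂ)⁻¹ • (Xᴴ * (Mᴴ * (Kᴴ * K) * M) * X) := by
            rw [Matrix.conjTranspose_smul, hst, Matrix.smul_mul, Matrix.mul_smul, smul_smul, hs]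
            simp only [Matrix.conjTranspose_mul, Matrix.mul_assoc]
        _ = (M * X)ᴴ * (M * X) := by
            rw [h, Matrix.mul_smul, Matrix.smul_mul, smul_smul, inv_mul_cancel₀ hl', one_smul]
            simp only [Matrix.conjTranspose_mul, Matrix.mul_assoc]
        _ = _ := hX
    have h' : ((1 - M * X)ᴴ * (1 - M * X)).PosSemidef :=
      Matrix.posSemidef_conjTranspose_mul_self _
    rw [IsContraction, e]
    convert h' using 1
    have hPP : M * X * (M * X) = M * X := by rw [← Matrix.mul_assoc, hXM]
    rw [Matrix.conjTranspose_sub, hPh, Matrix.conjTranspose_one]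
    simp only [Matrix.mul_sub, Matrix.sub_mul, Matrix.mul_one, Matrix.one_mul, hPP]
    abel
  · rw [Matrix.smul_mul, Matrix.mul_assoc, hXM]

/-- The vectorisation of a matrix; its norm is the Hilbert–Schmidt norm of the matrix. -/
noncomputable def hsVec : Matrix m n ℂ →ₗ[ℂ] EuclideanSpace ℂ (m × n) where
  toFun A := WithLp.toLp 2 fun q => A q.1 q.2
  map_add' _ _ := rfl
  map_smul' _ _ := rfl

omit [Fintype m] [Fintype n] in
theorem hsVec_injective : Function.Injective (hsVec : Matrix m n ℂ → _) := by
  intro A B h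
  ext i j
  exact congrArg (fun v : EuclideanSpace ℂ (m × n) => v (i, j)) h

theorem norm_hsVec_sq (A : Matrix m n ℂ) : ((‖hsVec A‖ ^ 2 : ℝ) : ℂ) = (Aᴴ * A).trace := by
  rw [EuclideanSpace.norm_sq_eq, Fintype.sum_prod_type, Finset.sum_comm, Matrix.trace]
  push_cast
  refine Finset.sum_congr rfl fun j _ => ?_
  rw [Matrix.diag_apply, Matrix.mul_apply]
  refine Finset.sum_congr rfl fun i _ => ?_
  rw [Matrix.conjTranspose_apply, ← Complex.ofReal_pow, ← Complex.normSq_eq_norm_sq,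
    Complex.normSq_eq_conj_mul_self]
  rfl

theorem norm_hsVec_eq_of_trace {m' n' : Type*} [Fintype m'] [Fintype n'] {A : Matrix m n ℂ}
    {B : Matrix m' n' ℂ} (h : (Aᴴ * A).trace = (Bᴴ * B).trace) : ‖hsVec A‖ = ‖hsVec B‖ := by
  rw [← norm_hsVec_sq, ← norm_hsVec_sq] at h
  have h' : ‖hsVec A‖ ^ 2 = ‖hsVec B‖ ^ 2 := by exact_mod_cast h
  exact (pow_left_inj₀ (norm_nonneg _) (norm_nonneg _) two_ne_zero).1 h'

theorem norm_hsVec_self_mul_conjTranspose (M : Matrix m n ℂ) :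
    ‖hsVec (M * Mᴴ)‖ = ‖hsVec (Mᴴ * M)‖ := by
  apply norm_hsVec_eq_of_trace
  simp only [Matrix.conjTranspose_mul, Matrix.conjTranspose_conjTranspose]
  rw [Matrix.mul_assoc, Matrix.trace_mul_comm]
  simp only [Matrix.mul_assoc]

theorem norm_hsVec_isometry_conj [DecidableEq n] {U : Matrix m n ℂ} (hU : Uᴴ * U = 1)
    (X : Matrix n n ℂ) :
    ‖hsVec (U * X * Uᴴ)‖ = ‖hsVec X‖ := by
  apply norm_hsVec_eq_of_trace
  have : (U * X * Uᴴ)ᴴ * (U * X * Uᴴ) = U * (Xᴴ * (Uᴴ * U) * X * Uᴴ) := by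
    simp only [Matrix.conjTranspose_mul, Matrix.conjTranspose_conjTranspose, Matrix.mul_assoc]
  rw [this, Matrix.trace_mul_comm, hU, Matrix.mul_one, Matrix.mul_assoc, hU, Matrix.mul_one]

end MatrixLemmas

/-- Equality in the triangle inequality for a finite sum in an inner product space. -/
theorem norm_smul_eq_of_norm_sum_eq {E α : Type*} [NormedAddCommGroup E] [InnerProductSpace ℂ E]
    [Fintype α] (x : α → E) (h : ‖∑ a, x a‖ = ∑ a, ‖x a‖) (a : α) :
    ‖∑ b, x b‖ • x a = ‖x a‖ • ∑ b, x b := by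
  classical
  let _ : InnerProductSpace ℝ E := InnerProductSpace.rclikeToReal ℂ E
  have hle : ∀ b ∈ Finset.univ, inner ℝ (x b) (∑ b, x b) ≤ ‖x b‖ * ‖∑ b, x b‖ :=
    fun b _ => real_inner_le_norm _ _
  have hsum : ∑ b, inner ℝ (x b) (∑ b, x b) = ∑ b, ‖x b‖ * ‖∑ b, x b‖ := by
    rw [← sum_inner, real_inner_self_eq_norm_mul_norm, ← Finset.sum_mul, ← h]
  exact inner_eq_norm_mul_iff_real.1
    ((Finset.sum_eq_sum_iff_of_le hle).1 hsum a (Finset.mem_univ a))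

/-! ### Tensor products of local operators -/

section Tensor

variable {ι : Type*} [Fintype ι] {d d' d'' : ι → ℕ}

theorem tensorOp_conjTranspose (A : ∀ i, Matrix (Fin (d' i)) (Fin (d i)) ℂ) :
    (tensorOp A)ᴴ = tensorOp fun i => (A i)ᴴ := by
  ext x y
  simp [tensorOp]

theorem tensorOp_one : tensorOp (fun i => (1 : Matrix (Fin (d i)) (Fin (d i)) ℂ)) = 1 := by
  classical
  ext x y
  simp only [tensorOp, Matrix.of_apply, Matrix.one_apply]
  by_cases h : x = y
  · simp [h]
  · rw [if_neg h]
    obtain ⟨i, hi⟩ := Function.ne_iff.1 h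
    exact Finset.prod_eq_zero (Finset.mem_univ i) (if_neg hi)

variable [DecidableEq ι]

theorem tensorOp_mul (A : ∀ i, Matrix (Fin (d'' i)) (Fin (d' i)) ℂ)
    (B : ∀ i, Matrix (Fin (d' i)) (Fin (d i)) ℂ) :
    tensorOp A * tensorOp B = tensorOp fun i => A i * B i := by
  ext x y
  simp only [tensorOp, Matrix.mul_apply, Matrix.of_apply, ← Finset.prod_mul_distrib]
  rw [Finset.prod_univ_sum, Fintype.piFinset_univ]

/-- The tensor product `1 ⊗ ⋯ ⊗ G ⊗ ⋯ ⊗ 1` with `G` at the party `k`, as a linear function of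
`G`. -/
noncomputable def singleOp (k : ι) : Matrix (Fin (d k)) (Fin (d k)) ℂ →ₗ[ℂ] Op d where
  toFun G := tensorOp (Function.update (fun _ => 1) k G)
  map_add' G H := by
    ext x y
    simp only [tensorOp, Matrix.of_apply, Matrix.add_apply,
      Fintype.prod_eq_mul_prod_subtype_ne _ k, Function.update_self, add_mul]
    congr 2 <;>
    exact Finset.prod_congr rfl fun i _ => by
      simp [Function.update_of_ne i.2]
  map_smul' c G := by
    ext x y
    simp only [tensorOp, Matrix.of_apply, Matrix.smul_apply, RingHom.id_apply,
      Fintype.prod_eq_mul_prod_subtype_ne _ k, Function.update_self, smul_mul_assoc]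
    congr 2
    exact Finset.prod_congr rfl fun i _ => by
      simp [Function.update_of_ne i.2]

theorem singleOp_one (k : ι) : singleOp (d := d) k 1 = 1 := by
  change tensorOp (Function.update (fun _ => 1) k 1) = 1
  rw [Function.update_eq_self_iff.2 rfl, tensorOp_one]

theorem tensorOp_isometry {A : ∀ i, Matrix (Fin (d' i)) (Fin (d i)) ℂ}
    (h : ∀ i, (A i)ᴴ * A i = 1) : (tensorOp A)ᴴ * tensorOp A = 1 := by
  rw [tensorOp_conjTranspose, tensorOp_mul]
  simp only [h, tensorOp_one]

/-- If all local operators but the one of party `k` are isometries, only party `k` contributes to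
`(⨂ A i)† (⨂ A i)`. -/
theorem tensorOp_conjTranspose_mul_self {A : ∀ i, Matrix (Fin (d' i)) (Fin (d i)) ℂ} {k : ι}
    (h : ∀ i, i ≠ k → (A i)ᴴ * A i = 1) :
    (tensorOp A)ᴴ * tensorOp A = singleOp k ((A k)ᴴ * A k) := by
  rw [tensorOp_conjTranspose, tensorOp_mul]
  change _ = tensorOp _
  congr 1
  funext i
  rcases eq_or_ne i k with rfl | hi
  · simp
  · rw [Function.update_of_ne hi, h i hi]

/-! ### Local operators acting on kets -/

/-- The action of an operator on a ket. -/
noncomputable def applyOp (M : Matrix (Conf d') (Conf d) ℂ) (ψ : Ket d) : Ket d' :=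
  WithLp.toLp 2 (M *ᵥ ψ.ofLp)

omit [DecidableEq ι] in
theorem proj_eq_vecMulVec (ψ : Ket d) : proj ψ = Matrix.vecMulVec ψ.ofLp (star ψ.ofLp) := rfl

omit [DecidableEq ι] in
theorem proj_smul (c : ℂ) (ψ : Ket d) : proj (c • ψ) = (c * star c) • proj ψ := by
  ext x y
  simp [proj]
  ring

theorem conjMap_proj (M : Matrix (Conf d') (Conf d) ℂ) (ψ : Ket d) :
    conjMap M (proj ψ) = proj (applyOp M ψ) := by
  change M * proj ψ * Mᴴ = _
  rw [proj_eq_vecMulVec, proj_eq_vecMulVec, applyOp, Matrix.mul_vecMulVec,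
    Matrix.vecMulVec_mul, Matrix.star_mulVec]

theorem conjMap_conjMap (M : Matrix (Conf d'') (Conf d') ℂ) (N : Matrix (Conf d') (Conf d) ℂ)
    (ρ : Op d) : conjMap M (conjMap N ρ) = conjMap (M * N) ρ := by
  change M * (N * ρ * Nᴴ) * Mᴴ = M * N * ρ * (M * N)ᴴ
  simp only [Matrix.conjTranspose_mul, Matrix.mul_assoc]

theorem conjMap_one (ρ : Op d) : conjMap 1 ρ = ρ := by
  change 1 * ρ * 1ᴴ = ρ
  simp

omit [DecidableEq ι] in
theorem proj_posSemidef (ψ : Ket d) : (proj ψ).PosSemidef := by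
  rw [proj_eq_vecMulVec]
  exact Matrix.posSemidef_vecMulVec_self_star _

theorem conjMap_posSemidef (M : Matrix (Conf d') (Conf d) ℂ) {ρ : Op d} (h : ρ.PosSemidef) :
    (conjMap M ρ).PosSemidef :=
  h.mul_mul_conjTranspose_same M

theorem trace_proj (ψ : Ket d) : (proj ψ).trace = ((‖ψ‖ ^ 2 : ℝ) : ℂ) := by
  rw [EuclideanSpace.norm_sq_eq, Matrix.trace]
  push_cast
  refine Finset.sum_congr rfl fun x _ => ?_
  rw [Matrix.diag_apply, ← Complex.ofReal_pow, ← Complex.normSq_eq_norm_sq,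
    Complex.normSq_eq_conj_mul_self, mul_comm]
  rfl

/-! ### Splitting off one party -/

/-- The matrix of the bipartite state `ψ` for the cut between party `j` and the others. -/
def slice (j : ι) (ψ : Ket d) :
    Matrix (Fin (d j)) (Conf fun i : {i // i ≠ j} => d i) ℂ :=
  Matrix.of fun a r => ψ ((Equiv.piSplitAt j fun i => Fin (d i)).symm (a, r))

theorem slice_injective (j : ι) : Function.Injective (slice j : Ket d → _) := by
  intro ψ φ h
  ext x
  obtain ⟨⟨a, r⟩, rfl⟩ := (Equiv.piSplitAt j fun i => Fin (d i)).symm.surjective x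
  exact congrFun (congrFun h a) r

theorem slice_applyOp (j : ι) (A : ∀ i, Matrix (Fin (d' i)) (Fin (d i)) ℂ) (ψ : Ket d) :
    slice j (applyOp (tensorOp A) ψ)
      = A j * slice j ψ * (tensorOp fun i : {i // i ≠ j} => A i)ᵀ := by
  ext a r
  have hsplit : ∀ {e : ι → ℕ} (b : Fin (e j)) (t : Conf fun i : {i // i ≠ j} => e i),
      (Equiv.piSplitAt j fun i => Fin (e i)).symm (b, t) j = b ∧
      ∀ i : {i // i ≠ j}, (Equiv.piSplitAt j fun i => Fin (e i)).symm (b, t) i = t i := by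
    intro e b t
    refine ⟨by simp, fun i => ?_⟩
    simp [Equiv.piSplitAt, i.2]
  simp only [slice, applyOp, Matrix.of_apply, Matrix.mulVec, dotProduct, Matrix.mul_apply,
    Matrix.transpose_apply]
  rw [← (Equiv.piSplitAt j fun i => Fin (d i)).symm.sum_comp, Fintype.sum_prod_type,
    Finset.sum_comm]
  refine Finset.sum_congr rfl fun t _ => ?_
  rw [Finset.sum_mul]
  refine Finset.sum_congr rfl fun b _ => ?_
  simp only [tensorOp, Matrix.of_apply, Fintype.prod_eq_mul_prod_subtype_ne _ j,
    (hsplit _ _).1, (hsplit _ _).2]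
  ring

theorem slice_smul (j : ι) (c : ℂ) (ψ : Ket d) : slice j (c • ψ) = c • slice j ψ := rfl

/-- The Hilbert–Schmidt norm of the (unnormalised) reduced state of the parties other than `j`,
which is also that of the reduced state of party `j`; its square is the purity. -/
noncomputable def redNorm (j : ι) (ψ : Ket d) : ℝ :=
  ‖hsVec ((slice j ψ)ᴴ * slice j ψ)‖

theorem redNorm_eq_zero {j : ι} {ψ : Ket d} : redNorm j ψ = 0 ↔ ψ = 0 := by
  rw [redNorm, norm_eq_zero, map_eq_zero_iff _ hsVec_injective,
    Matrix.conjTranspose_mul_self_eq_zero]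
  exact ⟨fun h => slice_injective j h, fun h => by rw [h]; rfl⟩

end Tensor

/-! ### One local instrument -/

section LocalInstrument

variable {ι : Type*} [Fintype ι] [DecidableEq ι] {d d' : ι → ℕ}

theorem transpose_mul_conjTranspose_transpose {m n : Type*} [Fintype m] [Fintype n]
    (T : Matrix m n ℂ) : Tᵀ * Tᵀᴴ = (Tᴴ * T)ᵀ := by
  rw [Matrix.transpose_mul]
  rfl

/-- The isometric action of the other parties on the complement of `k` preserves the
Hilbert–Schmidt norm, and only the operator of `k` remains. -/
theorem redNorm_applyOp_self {k : ι} {A : ∀ i, Matrix (Fin (d' i)) (Fin (d i)) ℂ}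
    (hA : ∀ i, i ≠ k → (A i)ᴴ * A i = 1) (ψ : Ket d) :
    redNorm k (applyOp (tensorOp A) ψ)
      = ‖hsVec ((slice k ψ)ᴴ * ((A k)ᴴ * A k) * slice k ψ)‖ := by
  have hT := tensorOp_isometry (A := fun i : {i // i ≠ k} => A i) fun i => hA i i.2
  have hU := transpose_mul_conjTranspose_transpose (tensorOp fun i : {i // i ≠ k} => A i)
  rw [hT, Matrix.transpose_one] at hU
  rw [redNorm, slice_applyOp]
  generalize (tensorOp fun i : {i // i ≠ k} => A i)ᵀ = T at hU
  rw [← norm_hsVec_isometry_conj (U := Tᴴ) (by simpa using hU)]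
  simp only [Matrix.conjTranspose_mul, Matrix.conjTranspose_conjTranspose, Matrix.mul_assoc]

/-- Seen from another party `j`, the operator of `k` acts on the complement of `j`, over which the
trace is taken, and enters through `A k† A k` alone. -/
theorem redNorm_applyOp_of_ne {j k : ι} (hkj : k ≠ j)
    {A : ∀ i, Matrix (Fin (d' i)) (Fin (d i)) ℂ}
    (hA : ∀ i, i ≠ k → (A i)ᴴ * A i = 1) (ψ : Ket d) :
    redNorm j (applyOp (tensorOp A) ψ)
      = ‖hsVec (slice j ψ *
          (singleOp (d := fun i : {i // i ≠ j} => d i) ⟨k, hkj⟩ ((A k)ᴴ * A k))ᵀ *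
          (slice j ψ)ᴴ)‖ := by
  have hT := tensorOp_conjTranspose_mul_self (A := fun i : {i // i ≠ j} => A i) (k := ⟨k, hkj⟩)
    fun i hi => hA i fun h => hi (Subtype.ext h)
  rw [redNorm, ← norm_hsVec_self_mul_conjTranspose, slice_applyOp, ← hT,
    ← transpose_mul_conjTranspose_transpose, ← norm_hsVec_isometry_conj (hA j hkj.symm)]
  simp only [Matrix.conjTranspose_mul, Matrix.mul_assoc]

variable {α : Type*} [Fintype α] {k : ι} {e : α → ι → ℕ}
  {A : ∀ a i, Matrix (Fin (e a i)) (Fin (d i)) ℂ}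

/-- Monotonicity of the purity under a local instrument of party `k` with Kraus operators `A a k`.
For `j ≠ k` the reduced state of `j` is, up to a local isometry, the sum of those after the
outcomes; for `j = k` this holds for the reduced state of the other parties. -/
theorem redNorm_le_sum (hA : ∀ a i, i ≠ k → (A a i)ᴴ * A a i = 1)
    (hsum : ∑ a, (A a k)ᴴ * A a k = 1) (j : ι) (ψ : Ket d) :
    redNorm j ψ ≤ ∑ a, redNorm j (applyOp (tensorOp (A a)) ψ) := by
  rcases eq_or_ne k j with rfl | hkj
  · simp only [fun a => redNorm_applyOp_self (hA a) ψ]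
    refine le_of_eq_of_le ?_ (norm_sum_le _ _)
    rw [← map_sum, ← Matrix.sum_mul, ← Matrix.mul_sum, hsum, Matrix.mul_one, redNorm]
  · simp only [fun a => redNorm_applyOp_of_ne hkj (hA a) ψ]
    refine le_of_eq_of_le ?_ (norm_sum_le _ _)
    rw [← map_sum, ← Matrix.sum_mul, ← Matrix.mul_sum, ← Matrix.transpose_sum, ← map_sum, hsum,
      singleOp_one, Matrix.transpose_one, Matrix.mul_one, redNorm,
      norm_hsVec_self_mul_conjTranspose]

/-- If the measurement of party `k` does not change the average Hilbert–Schmidt norm of the reduced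
state of the other parties, then strict convexity shows that this reduced state is the same, up to
its trace, after each outcome. The post-measurement state is then another purification of it, and
can be reached from `ψ` by a local contraction. -/
theorem exists_contraction_of_redNorm_eq (hA : ∀ a i, i ≠ k → (A a i)ᴴ * A a i = 1)
    (hsum : ∑ a, (A a k)ᴴ * A a k = 1) {ψ : Ket d}
    (h : redNorm k ψ = ∑ a, redNorm k (applyOp (tensorOp (A a)) ψ)) {a : α}
    (ha : applyOp (tensorOp (A a)) ψ ≠ 0) :
    ∃ C : ∀ i, Matrix (Fin (e a i)) (Fin (d i)) ℂ, (∀ i, IsContraction (C i)) ∧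
      ((redNorm k (applyOp (tensorOp (A a)) ψ) : ℝ) : ℂ) • conjMap (tensorOp C) (proj ψ)
        = ((redNorm k ψ : ℝ) : ℂ) • proj (applyOp (tensorOp (A a)) ψ) := by
  have hpos : ∀ {f : ι → ℕ} {χ : Ket f}, χ ≠ 0 → 0 < redNorm k χ := fun hχ =>
    lt_of_le_of_ne (norm_nonneg _) fun h0 => hχ (redNorm_eq_zero.1 h0.symm)
  have hψ : ψ ≠ 0 := by
    rintro rfl
    exact ha (by simp [applyOp])
  have hr := hpos hψ
  have hra := hpos ha
  have hsum' : ∑ b, hsVec ((slice k ψ)ᴴ * ((A b k)ᴴ * A b k) * slice k ψ)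
      = hsVec ((slice k ψ)ᴴ * slice k ψ) := by
    rw [← map_sum, ← Matrix.sum_mul, ← Matrix.mul_sum, hsum, Matrix.mul_one]
  have heq := norm_smul_eq_of_norm_sum_eq
    (fun b => hsVec ((slice k ψ)ᴴ * ((A b k)ᴴ * A b k) * slice k ψ))
    (by
      rw [hsum']
      change redNorm k ψ = _
      simpa only [fun b => redNorm_applyOp_self (hA b) ψ] using h) a
  simp only [hsum', ← redNorm_applyOp_self (hA a) ψ] at heq
  set r := redNorm k ψ with hrdef
  set ra := redNorm k (applyOp (tensorOp (A a)) ψ) with hradef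
  change r • _ = ra • _ at heq
  have hprop : (slice k ψ)ᴴ * ((A a k)ᴴ * A a k) * slice k ψ
      = ((ra / r : ℝ) : ℂ) • ((slice k ψ)ᴴ * slice k ψ) := by
    apply hsVec_injective
    rw [map_smul, Complex.coe_smul, div_eq_inv_mul, mul_smul, ← heq, smul_smul,
      inv_mul_cancel₀ hr.ne', one_smul]
  obtain ⟨B, hB, hBM⟩ := exists_contraction_mul_eq (div_pos hra hr) hprop
  -- On `ψ`, the contraction `B` acts as `A a k` up to a scalar, so it may take its place.
  refine ⟨Function.update (A a) k B, fun i => ?_, ?_⟩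
  · rcases eq_or_ne i k with rfl | hi
    · simpa using hB
    · rw [Function.update_of_ne hi]
      exact IsContraction.of_isometry (hA a i hi)
  · have hC : applyOp (tensorOp (Function.update (A a) k B)) ψ
        = ((√(ra / r))⁻¹ : ℂ) • applyOp (tensorOp (A a)) ψ := by
      apply slice_injective k
      rw [slice_smul, slice_applyOp, slice_applyOp, Function.update_self, hBM, Matrix.smul_mul]
      congr 4
      funext i
      exact Function.update_of_ne i.2 _ _
    have hsq : ((√(ra / r))⁻¹ : ℂ) * star ((√(ra / r))⁻¹ : ℂ) = ((r / ra : ℝ) : ℂ) := by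
      rw [star_inv₀, ← mul_inv, Complex.star_def, Complex.conj_ofReal, ← Complex.ofReal_mul,
        Real.mul_self_sqrt (div_pos hra hr).le, ← Complex.ofReal_inv, inv_div]
    rw [conjMap_proj, hC, proj_smul, hsq, smul_smul, ← Complex.ofReal_mul,
      mul_div_cancel₀ _ hra.ne']

/-! ### The local families of a protocol step -/

/-- The identity matrix between spaces whose dimensions are only propositionally equal is an
isometry. -/
theorem natDiag_isometry {m n : ℕ} (h : m = n) :
    (Matrix.of fun (x : Fin m) (y : Fin n) => if (x : ℕ) = (y : ℕ) then (1 : ℂ) else 0)ᴴ *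
      (Matrix.of fun (x : Fin m) (y : Fin n) => if (x : ℕ) = (y : ℕ) then (1 : ℂ) else 0) = 1 := by
  subst h
  have : (Matrix.of fun (x y : Fin m) => if (x : ℕ) = (y : ℕ) then (1 : ℂ) else 0) = 1 := by
    ext x y
    simp [Matrix.one_apply, Fin.ext_iff]
  rw [this]
  simp

omit [Fintype ι] in
theorem localFamily_isometry_of_ne {k i : ι} (hi : i ≠ k) {e : ℕ}
    (B : Matrix (Fin e) (Fin (d k)) ℂ) :
    (localFamily k B i)ᴴ * localFamily k B i = 1 := by
  have : localFamily k B i =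
      Matrix.of fun (x : Fin _) (y : Fin _) => if (x : ℕ) = (y : ℕ) then (1 : ℂ) else 0 := by
    ext x y
    simp [localFamily, hi]
  rw [this]
  exact natDiag_isometry (Function.update_of_ne hi _ _)

omit [Fintype ι] in
theorem localFamily_self (k : ι) {e : ℕ} (B : Matrix (Fin e) (Fin (d k)) ℂ) :
    localFamily k B k = B.submatrix (Fin.cast (Function.update_self k e d)) id := by
  ext x y
  simp [localFamily]

omit [Fintype ι] in
theorem localFamily_self_conjTranspose_mul (k : ι) {e : ℕ} (B : Matrix (Fin e) (Fin (d k)) ℂ) :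
    (localFamily k B k)ᴴ * localFamily k B k = Bᴴ * B := by
  rw [localFamily_self, Matrix.conjTranspose_submatrix]
  exact Matrix.submatrix_mul_equiv Bᴴ B id (finCongr (Function.update_self k e d)) id

end LocalInstrument

/-! ### Superoperators of protocols -/

section Superop

variable {ι : Type*} [Fintype ι] [DecidableEq ι] {d d' : ι → ℕ}

theorem Protocol.superop_step_apply (k : ι) (I : Instrument (d k))
    (next : ∀ a : Fin I.outcomes, Protocol d' (Function.update d k (I.dim a))) (ρ : Op d) :
    (Protocol.step k I next).superop ρ
      = ∑ a, (next a).superop (∑ s, conjMap (tensorOp (localFamily k (I.kraus a s))) ρ) := by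
  simp [Protocol.superop]

theorem Protocol.superop_posSemidef {d : ι → ℕ} (P : Protocol d' d) :
    ∀ {ρ : Op d}, ρ.PosSemidef → (P.superop ρ).PosSemidef := by
  induction P with
  | done => exact fun h => h
  | step k I next ih =>
    intro ρ h
    rw [Protocol.superop_step_apply]
    exact Matrix.posSemidef_sum _ fun a _ => ih a <|
      Matrix.posSemidef_sum _ fun s _ => conjMap_posSemidef _ h

theorem trace_conjMap (M : Matrix (Conf d') (Conf d) ℂ) (ρ : Op d) :
    (conjMap M ρ).trace = (Mᴴ * M * ρ).trace := by
  change (M * ρ * Mᴴ).trace = _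
  rw [Matrix.trace_mul_comm, Matrix.mul_assoc]

theorem Protocol.trace_superop {d : ι → ℕ} (P : Protocol d' d) :
    ∀ ρ : Op d, (P.superop ρ).trace = ρ.trace := by
  induction P with
  | done => exact fun _ => rfl
  | step k I next ih =>
    intro ρ
    rw [Protocol.superop_step_apply, Matrix.trace_sum]
    simp only [ih, Matrix.trace_sum, trace_conjMap,
      fun a s => tensorOp_conjTranspose_mul_self (A := localFamily k (I.kraus a s)) (k := k)
        fun i hi => localFamily_isometry_of_ne hi _,
      localFamily_self_conjTranspose_mul]
    simp only [← Matrix.trace_sum, ← Matrix.sum_mul, ← map_sum, I.complete, singleOp_one,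
      Matrix.one_mul]

/-! ### Pure states are extremal -/

theorem proj_mul_proj {φ : Ket d} (hφ : ‖φ‖ = 1) : proj φ * proj φ = proj φ := by
  have h := trace_proj φ
  rw [hφ, proj_eq_vecMulVec, Matrix.trace_vecMulVec, dotProduct_comm] at h
  rw [proj_eq_vecMulVec, Matrix.vecMulVec_mul_vecMulVec, h]
  simp

/-- Positive operators that sum to a multiple of the pure state `φ` are themselves multiples of
it. -/
theorem eq_smul_proj_of_sum_eq {α : Type*} [Fintype α] {Q : α → Op d} {φ : Ket d} (hφ : ‖φ‖ = 1)
    {c : ℂ} (hQ : ∀ a, (Q a).PosSemidef) (hsum : ∑ a, Q a = c • proj φ) (a : α) :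
    ∃ r : ℝ, Q a = (r : ℂ) • proj φ := by
  have hPP := proj_mul_proj hφ
  have hPh : (proj φ)ᴴ = proj φ := (proj_posSemidef φ).isHermitian
  have hRh : (1 - proj φ)ᴴ = 1 - proj φ := by rw [Matrix.conjTranspose_sub, hPh]; simp
  -- The compression of the sum to the complement of `φ` vanishes, so that of each summand does.
  have hcomp : ∀ b, ((1 - proj φ)ᴴ * Q b * (1 - proj φ)).PosSemidef :=
    fun b => (hQ b).conjTranspose_mul_mul_same _
  have hz : ∑ b, ((1 - proj φ)ᴴ * Q b * (1 - proj φ)).trace = 0 := by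
    rw [← Matrix.trace_sum, ← Matrix.sum_mul, ← Matrix.mul_sum, hsum, hRh]
    simp [Matrix.sub_mul, hPP]
  have hza := (hcomp a).trace_eq_zero_iff.1
    ((Finset.sum_eq_zero_iff_of_nonneg fun b _ => (hcomp b).trace_nonneg).1 hz a
      (Finset.mem_univ a))
  obtain ⟨B, hB⟩ := exists_conjTranspose_mul_self (hQ a)
  have hBz : B * (1 - proj φ) = 0 := by
    rw [← Matrix.conjTranspose_mul_self_eq_zero, Matrix.conjTranspose_mul, ← hza, ← hB]
    simp only [Matrix.mul_assoc]
  have hBP : B = B * proj φ := by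
    rw [Matrix.mul_sub, Matrix.mul_one, sub_eq_zero] at hBz
    exact hBz
  have hz : ∃ z : ℂ, Q a = z • proj φ := by
    refine ⟨star φ.ofLp ⬝ᵥ (Q a *ᵥ φ.ofLp), ?_⟩
    have : Q a = proj φ * Q a * proj φ := by
      rw [← hB]
      conv_lhs => rw [hBP, Matrix.conjTranspose_mul, hPh]
      simp only [Matrix.mul_assoc]
    conv_lhs => rw [this]
    rw [proj_eq_vecMulVec, Matrix.mul_assoc, Matrix.mul_vecMulVec, Matrix.vecMulVec_mul_vecMulVec,
      Matrix.vecMulVec_smul]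
  obtain ⟨z, hz⟩ := hz
  have htr := (hQ a).trace_nonneg
  rw [hz, Matrix.trace_smul, trace_proj, hφ] at htr
  have hz0 : 0 ≤ z := by simpa using htr
  refine ⟨z.re, ?_⟩
  rw [hz]
  congr 1
  exact Complex.ext rfl (by simpa using (Complex.le_def.1 hz0).2.symm)

/-! ### Entanglement monotonicity along a protocol -/

theorem redNorm_of_proj_eq {ψ φ : Ket d} (hφ : ‖φ‖ = 1) {c : ℝ} (h : proj ψ = (c : ℂ) • proj φ)
    (j : ι) : redNorm j ψ = c * redNorm j φ := by
  have hc : 0 ≤ c := by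
    have ht := congrArg Matrix.trace h
    rw [Matrix.trace_smul, trace_proj, trace_proj, hφ] at ht
    have ht' : ((‖ψ‖ ^ 2 : ℝ) : ℂ) = c := by simpa using ht
    rw [← Complex.ofReal_inj.1 ht']
    positivity
  have hs : (slice j ψ)ᴴ * slice j ψ = (c : ℂ) • ((slice j φ)ᴴ * slice j φ) := by
    ext r s
    simp only [Matrix.mul_apply, Matrix.smul_apply, Matrix.conjTranspose_apply, smul_eq_mul,
      Finset.mul_sum]
    refine Finset.sum_congr rfl fun a _ => ?_
    have := congrFun (congrFun h ((Equiv.piSplitAt j fun i => Fin (d i)).symm (a, s)))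
      ((Equiv.piSplitAt j fun i => Fin (d i)).symm (a, r))
    rw [mul_comm, mul_comm (star (slice j φ a r))]
    exact this
  rw [redNorm, hs, map_smul, norm_smul, Complex.norm_real, Real.norm_of_nonneg hc, redNorm]

/-- The Hilbert–Schmidt norms of all reduced states do not decrease on average under LOCC, and if
none of them changes, the conversion of `ψ` can also be performed by local contractions. -/
theorem redNorm_le_and_exists_contraction {φ : Ket d'} (hφ : ‖φ‖ = 1) {d : ι → ℕ}
    (P : Protocol d' d) : ∀ (ψ : Ket d) (c : ℝ), P.superop (proj ψ) = (c : ℂ) • proj φ →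
      (∀ j, redNorm j ψ ≤ c * redNorm j φ) ∧
      (ψ ≠ 0 → (∀ j, redNorm j ψ = c * redNorm j φ) →
        ∃ C : ∀ i, Matrix (Fin (d' i)) (Fin (d i)) ℂ, (∀ i, IsContraction (C i)) ∧
          conjMap (tensorOp C) (proj ψ) = (c : ℂ) • proj φ) := by
  induction P with
  | done =>
    intro ψ c h
    change proj ψ = _ at h
    exact ⟨fun j => (redNorm_of_proj_eq hφ h j).le, fun _ _ =>
      ⟨fun _ => 1, fun _ => IsContraction.of_isometry (by simp),
        by rw [tensorOp_one, conjMap_one, h]⟩⟩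
  | @step d k I next ih =>
    intro ψ c h
    -- The outcomes are refined so that every branch carries a single Kraus operator.
    let χ : ∀ a : (Σ a, Fin (I.rank a)), Ket (Function.update d k (I.dim a.1)) :=
      fun a => applyOp (tensorOp (localFamily k (I.kraus a.1 a.2))) ψ
    have hsum : ∑ a : (Σ a, Fin (I.rank a)), (next a.1).superop (proj (χ a)) =
        (c : ℂ) • proj φ := by
      rw [← h, Protocol.superop_step_apply, Fintype.sum_sigma]
      simp only [map_sum, conjMap_proj, χ]
    have hA : ∀ (a : Σ a, Fin (I.rank a)) i, i ≠ k →
        (localFamily k (I.kraus a.1 a.2) i)ᴴ * localFamily k (I.kraus a.1 a.2) i = 1 :=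
      fun a i hi => localFamily_isometry_of_ne hi _
    have hK : ∑ a : (Σ a, Fin (I.rank a)),
        (localFamily k (I.kraus a.1 a.2) k)ᴴ * localFamily k (I.kraus a.1 a.2) k = 1 := by
      simp only [localFamily_self_conjTranspose_mul]
      rw [Fintype.sum_sigma, I.complete]
    choose r hr using eq_smul_proj_of_sum_eq hφ
      (fun a => (next a.1).superop_posSemidef (proj_posSemidef (χ a))) hsum
    have hrc : ∑ a, r a = c := by
      have ht := congrArg Matrix.trace hsum
      simp only [hr, ← Finset.sum_smul, Matrix.trace_smul, trace_proj, hφ] at ht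
      have ht' : ((∑ a, r a : ℝ) : ℂ) = c := by simpa using ht
      exact Complex.ofReal_inj.1 ht'
    have hle : ∀ a j, redNorm j (χ a) ≤ r a * redNorm j φ := fun a => (ih a.1 (χ a) (r a) (hr a)).1
    have hmono : ∀ j, redNorm j ψ ≤ ∑ a, redNorm j (χ a) := fun j => redNorm_le_sum hA hK j ψ
    have hsle : ∀ j, ∑ a, redNorm j (χ a) ≤ c * redNorm j φ := fun j => by
      rw [← hrc, Finset.sum_mul]
      exact Finset.sum_le_sum fun a _ => hle a j
    refine ⟨fun j => (hmono j).trans (hsle j), fun hψ heq => ?_⟩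
    have heq' : ∀ a j, redNorm j (χ a) = r a * redNorm j φ := fun a j =>
      (Finset.sum_eq_sum_iff_of_le fun a _ => hle a j).1
        (le_antisymm (Finset.sum_le_sum fun a _ => hle a j)
          (by rw [← Finset.sum_mul, hrc, ← heq]; exact hmono j)) a (Finset.mem_univ a)
    have heqk : redNorm k ψ = ∑ a, redNorm k (χ a) :=
      le_antisymm (hmono k) (by rw [heq]; exact hsle k)
    obtain ⟨a, ha⟩ : ∃ a, χ a ≠ 0 := by
      by_contra! hall
      apply hψ
      rw [← redNorm_eq_zero (j := k), heqk]
      exact Finset.sum_eq_zero fun a _ => redNorm_eq_zero.2 (hall a)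
    obtain ⟨B, hB, hBψ⟩ := exists_contraction_of_redNorm_eq hA hK heqk ha
    obtain ⟨C, hC, hCχ⟩ := (ih a.1 (χ a) (r a) (hr a)).2 ha (heq' a)
    refine ⟨fun i => C i * B i, fun i => (hC i).mul (hB i), ?_⟩
    have hne : ((redNorm k (χ a) : ℝ) : ℂ) ≠ 0 := by
      exact_mod_cast fun h0 => ha (redNorm_eq_zero.1 h0)
    have hfin := congrArg (conjMap (tensorOp C)) hBψ
    rw [map_smul, map_smul, conjMap_conjMap, tensorOp_mul, hCχ] at hfin
    apply smul_right_injective _ hne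
    change _ = _ • _
    refine hfin.trans ?_
    rw [smul_smul, smul_smul, heq' a k, heq k]
    congr 1
    push_cast
    ring

end Superop

/-! ### Local contractions and local isometries -/

section LocalUnitary

variable {ι : Type*} [Fintype ι] [DecidableEq ι] {d d' : ι → ℕ}

/-- A contraction dilates to a pair of isometries: with `A† A + B† B = 1`, take `V = (A, B)` and
the inclusion `W = (1, 0)`. -/
theorem IsContraction.exists_dilation {m n : ℕ} {A : Matrix (Fin m) (Fin n) ℂ}
    (hA : IsContraction A) :
    ∃ (V : Matrix (Fin (m + n)) (Fin n) ℂ) (W : Matrix (Fin (m + n)) (Fin m) ℂ),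
      Vᴴ * V = 1 ∧ Wᴴ * W = 1 ∧ Wᴴ * V = A := by
  obtain ⟨B, hB⟩ := exists_conjTranspose_mul_self hA
  have key : ∀ {p q : ℕ} (X : Matrix (Fin m ⊕ Fin n) (Fin p) ℂ)
      (Y : Matrix (Fin m ⊕ Fin n) (Fin q) ℂ),
      (X.submatrix finSumFinEquiv.symm id)ᴴ * Y.submatrix finSumFinEquiv.symm id = Xᴴ * Y := by
    intro p q X Y
    rw [Matrix.conjTranspose_submatrix]
    exact Matrix.submatrix_mul_equiv Xᴴ Y id finSumFinEquiv.symm id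
  refine ⟨(Matrix.fromRows A B).submatrix finSumFinEquiv.symm id,
    (Matrix.fromRows 1 0).submatrix finSumFinEquiv.symm id, ?_, ?_, ?_⟩
  · rw [key, Matrix.conjTranspose_fromRows_eq_fromCols_conjTranspose, Matrix.fromCols_mul_fromRows,
      hB]
    simp
  · rw [key, Matrix.conjTranspose_fromRows_eq_fromCols_conjTranspose, Matrix.fromCols_mul_fromRows]
    simp
  · rw [key, Matrix.conjTranspose_fromRows_eq_fromCols_conjTranspose, Matrix.fromCols_mul_fromRows]
    simp

theorem norm_applyOp_sq (M : Matrix (Conf d') (Conf d) ℂ) (ψ : Ket d) :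
    ((‖applyOp M ψ‖ ^ 2 : ℝ) : ℂ) = (Mᴴ * M * proj ψ).trace := by
  rw [← trace_proj, ← conjMap_proj, trace_conjMap]

/-- If local contractions map the unit vector `ψ` to the unit vector `φ`, no norm is lost, so the
dilated vector lies in the range of the inclusion of the smaller spaces. -/
theorem luEquiv_of_contraction {ψ : Ket d} {φ : Ket d'} (hψ : ‖ψ‖ = 1) (hφ : ‖φ‖ = 1)
    {A : ∀ i, Matrix (Fin (d' i)) (Fin (d i)) ℂ} (hA : ∀ i, IsContraction (A i))
    (h : conjMap (tensorOp A) (proj ψ) = proj φ) : LUEquiv ψ φ := by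
  choose V W hV hW hWV using fun i => (hA i).exists_dilation
  refine ⟨_, V, W, hV, hW, ?_⟩
  have hTV := tensorOp_isometry hV
  have hTW := tensorOp_isometry hW
  have hTA : (tensorOp W)ᴴ * tensorOp V = tensorOp A := by
    rw [tensorOp_conjTranspose, tensorOp_mul]
    simp only [hWV]
  generalize tensorOp V = TV at *
  generalize tensorOp W = TW at *
  have hrange : applyOp TV ψ = applyOp (TW * tensorOp A) ψ := by
    -- The norm of the difference `(1 - W W†) V ψ` is `‖ψ‖ ^ 2 - ‖A ψ‖ ^ 2 = 0`.
    have hAA : ((tensorOp A)ᴴ * tensorOp A * proj ψ).trace = 1 := by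
      rw [← trace_conjMap, h, trace_proj, hφ]
      simp
    have hdiff : applyOp (TV - TW * tensorOp A) ψ = applyOp TV ψ - applyOp (TW * tensorOp A) ψ := by
      simp only [applyOp, Matrix.sub_mulVec]
      rfl
    have hz : ((‖applyOp (TV - TW * tensorOp A) ψ‖ ^ 2 : ℝ) : ℂ) = 0 := by
      have e : (TV - TW * tensorOp A)ᴴ * (TV - TW * tensorOp A)
          = 1 - (tensorOp A)ᴴ * tensorOp A := by
        have e1 : TVᴴ * TW = (tensorOp A)ᴴ := by rw [← hTA]; simp
        have e2 : TWᴴ * (TW * tensorOp A) = tensorOp A := by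
          rw [← Matrix.mul_assoc, hTW, Matrix.one_mul]
        have e3 : TVᴴ * (TW * tensorOp A) = (tensorOp A)ᴴ * tensorOp A := by
          rw [← Matrix.mul_assoc, e1]
        simp only [Matrix.conjTranspose_sub, Matrix.conjTranspose_mul, Matrix.sub_mul,
          Matrix.mul_sub, Matrix.mul_assoc, e2, e3, hTV, hTA]
        abel
      rw [norm_applyOp_sq, e, Matrix.sub_mul, Matrix.trace_sub, hAA, Matrix.one_mul, trace_proj, hψ]
      simp
    rw [← sub_eq_zero, ← hdiff, ← norm_eq_zero]
    exact pow_eq_zero_iff two_ne_zero |>.1 (Complex.ofReal_eq_zero.1 hz)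
  rw [conjMap_proj, hrange, ← conjMap_proj, ← conjMap_conjMap, h]

theorem LUEquiv.exists_contraction {ψ : Ket d} {φ : Ket d'} (h : LUEquiv ψ φ) :
    ∃ A : ∀ i, Matrix (Fin (d' i)) (Fin (d i)) ℂ, (∀ i, IsContraction (A i)) ∧
      conjMap (tensorOp A) (proj ψ) = proj φ := by
  obtain ⟨D, V, W, hV, hW, h⟩ := h
  refine ⟨fun i => (W i)ᴴ * V i, fun i => IsContraction.conjTranspose_mul (hW i) (hV i), ?_⟩
  rw [← tensorOp_mul, ← conjMap_conjMap, h, conjMap_conjMap, ← tensorOp_conjTranspose,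
    tensorOp_isometry hW, conjMap_one]

theorem LUEquiv.symm {ψ : Ket d} {φ : Ket d'} (h : LUEquiv ψ φ) : LUEquiv φ ψ := by
  obtain ⟨D, V, W, hV, hW, h⟩ := h
  exact ⟨D, W, V, hW, hV, h.symm⟩

/-! ### Implementing local contractions by LOCC -/

/-- A contraction is one Kraus operator of an instrument with a single outcome. The defect
`1 - A† A = B† B` is made up for by resetting to a fixed basis vector `z`: one Kraus operator
`|z⟩⟨j| B` for each row `j` of `B`. -/
theorem IsContraction.exists_kraus {m n : ℕ} (z : Fin m) {A : Matrix (Fin m) (Fin n) ℂ}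
    (hA : IsContraction A) :
    ∃ K : Fin (n + 1) → Matrix (Fin m) (Fin n) ℂ, K 0 = A ∧ ∑ s, (K s)ᴴ * K s = 1 := by
  obtain ⟨B, hB⟩ := exists_conjTranspose_mul_self hA
  refine ⟨Fin.cons A fun j => Matrix.single z j (1 : ℂ) * B, rfl, ?_⟩
  have hj : ∀ j : Fin n, (Matrix.single z j (1 : ℂ) * B)ᴴ * (Matrix.single z j (1 : ℂ) * B)
      = Bᴴ * Matrix.single j j (1 : ℂ) * B := by
    intro j
    have : (Matrix.single z j (1 : ℂ))ᴴ * Matrix.single z j (1 : ℂ) = Matrix.single j j 1 := by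
      simp [Matrix.conjTranspose_single]
    rw [Matrix.conjTranspose_mul, ← this]
    simp only [Matrix.mul_assoc]
  have h1 : ∑ j : Fin n, Matrix.single j j (1 : ℂ) = 1 := by
    ext a b
    simp [Matrix.sum_apply, Matrix.single_apply, Matrix.one_apply, ite_and]
  rw [Fin.sum_univ_succ]
  simp only [Fin.cons_zero, Fin.cons_succ, hj]
  rw [← Matrix.sum_mul, ← Matrix.mul_sum, h1, Matrix.mul_one, hB]
  abel

/-- The family that remains to be applied after party `k` has applied its operator. -/
noncomputable def remainingFamily (A : ∀ i, Matrix (Fin (d' i)) (Fin (d i)) ℂ) (k i : ι) :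
    Matrix (Fin (d' i)) (Fin (Function.update d k (d' k) i)) ℂ :=
  Matrix.of fun x y =>
    if h : i = k then (if (x : ℕ) = (y : ℕ) then 1 else 0)
    else A i x (Fin.cast (Function.update_of_ne h _ _) y)

omit [Fintype ι] in
theorem remainingFamily_of_ne (A : ∀ i, Matrix (Fin (d' i)) (Fin (d i)) ℂ) {k i : ι} (h : i ≠ k) :
    remainingFamily A k i =
      (A i).submatrix id (finCongr (Function.update_of_ne h (d' k) d)) := by
  ext x y
  simp [remainingFamily, h]

omit [Fintype ι] in
theorem remainingFamily_self (A : ∀ i, Matrix (Fin (d' i)) (Fin (d i)) ℂ) (k : ι) :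
    remainingFamily A k k =
      (1 : Matrix (Fin (d' k)) (Fin (d' k)) ℂ).submatrix id
        (finCongr (Function.update_self k (d' k) d)) := by
  ext x y
  simp [remainingFamily, Matrix.one_apply, Fin.ext_iff]

omit [Fintype ι] in
theorem remainingFamily_mul_localFamily (A : ∀ i, Matrix (Fin (d' i)) (Fin (d i)) ℂ) (k i : ι) :
    remainingFamily A k i * localFamily k (A k) i = A i := by
  rcases eq_or_ne i k with rfl | h
  · rw [remainingFamily_self, localFamily_self]
    exact (Matrix.submatrix_mul_equiv 1 (A i) id
      (finCongr (Function.update_self i (d' i) d)) id).trans (by rw [Matrix.one_mul, Matrix.submatrix_id_id])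
  · have : localFamily k (A k) i = (1 : Matrix (Fin (d i)) (Fin (d i)) ℂ).submatrix
        (finCongr (Function.update_of_ne h (d' k) d)) id := by
      ext x y
      simp [localFamily, h, Matrix.one_apply, Fin.ext_iff]
    rw [remainingFamily_of_ne A h, this, Matrix.submatrix_mul_equiv, Matrix.mul_one,
      Matrix.submatrix_id_id]

theorem IsContraction.submatrix_id_equiv {m n p : Type*} [Fintype m] [Fintype n] [Fintype p]
    [DecidableEq n] [DecidableEq p] {A : Matrix m n ℂ} (hA : IsContraction A) (e : p ≃ n) :
    IsContraction (A.submatrix id e) := by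
  have h := hA.submatrix e
  rw [IsContraction, Matrix.conjTranspose_submatrix]
  convert h using 1
  rw [← Matrix.submatrix_one_equiv e]
  rfl

omit [Fintype ι] in
theorem isContraction_remainingFamily {A : ∀ i, Matrix (Fin (d' i)) (Fin (d i)) ℂ}
    (hA : ∀ i, IsContraction (A i)) (k i : ι) : IsContraction (remainingFamily A k i) := by
  rcases eq_or_ne i k with rfl | h
  · rw [remainingFamily_self]
    exact (IsContraction.of_isometry (by simp)).submatrix_id_equiv _
  · rw [remainingFamily_of_ne A h]
    exact (hA i).submatrix_id_equiv _

/-- Local contractions are dominated by an LOCC protocol in which the parties of `s` act one after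
the other; the other parties hold their final systems already. -/
theorem exists_protocol_dominating (hd' : ∀ i, 0 < d' i) (s : Finset ι) :
    ∀ {d : ι → ℕ} (A : ∀ i, Matrix (Fin (d' i)) (Fin (d i)) ℂ), (∀ i, IsContraction (A i)) →
      (∀ i, i ∉ s → d i = d' i ∧
        A i = Matrix.of fun (x : Fin _) (y : Fin _) => if (x : ℕ) = (y : ℕ) then 1 else 0) →
      ∃ P : Protocol d' d, ∀ ρ : Op d, ρ.PosSemidef →
        (P.superop ρ - conjMap (tensorOp A) ρ).PosSemidef := by
  induction s using Finset.induction_on with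
  | empty =>
    intro d A _ hs
    obtain rfl : d = d' := funext fun i => (hs i (Finset.notMem_empty i)).1
    refine ⟨.done, fun ρ _ => ?_⟩
    have : A = fun i => 1 := by
      funext i
      rw [(hs i (Finset.notMem_empty i)).2]
      ext x y
      simp [Matrix.one_apply, Fin.ext_iff]
    rw [this, tensorOp_one, conjMap_one]
    change (ρ - ρ).PosSemidef
    rw [sub_self]
    exact Matrix.PosSemidef.zero
  | insert k s hk ih =>
    intro d A hA hs
    obtain ⟨K, hK0, hK⟩ := (hA k).exists_kraus ⟨0, hd' k⟩
    obtain ⟨P, hP⟩ := ih (remainingFamily A k) (isContraction_remainingFamily hA k) (by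
      intro i hi
      rcases eq_or_ne i k with rfl | hik
      · refine ⟨Function.update_self _ _ _, ?_⟩
        ext x y
        simp [remainingFamily]
      · obtain ⟨h1, h2⟩ := hs i (by simp [hik, hi])
        refine ⟨(Function.update_of_ne hik _ _).trans h1, ?_⟩
        ext x y
        simp [remainingFamily, hik, h2])
    let I : Instrument (d k) :=
      { outcomes := 1, dim := fun _ => d' k, rank := fun _ => d k + 1, kraus := fun _ => K,
        complete := by simpa using hK }
    refine ⟨.step k I fun _ => P, fun ρ hρ => ?_⟩
    have hstep : (Protocol.step k I fun _ => P).superop ρ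
        = P.superop (∑ s, conjMap (tensorOp (localFamily k (K s))) ρ) := by
      rw [Protocol.superop_step_apply]
      exact Fin.sum_univ_one _
    have hcomp : conjMap (tensorOp A) ρ
        = conjMap (tensorOp (remainingFamily A k))
            (conjMap (tensorOp (localFamily k (A k))) ρ) := by
      rw [conjMap_conjMap, tensorOp_mul]
      simp only [remainingFamily_mul_localFamily]
    rw [hstep, hcomp, Fin.sum_univ_succ, hK0, map_add, add_sub_right_comm]
    exact (hP _ (conjMap_posSemidef _ hρ)).add <| P.superop_posSemidef <|
      Matrix.posSemidef_sum _ fun s _ => conjMap_posSemidef _ hρ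

/-- A protocol dominating the contractions preserves the trace, so on `ψ`, whose image under the
contractions is normalised, nothing is left for the remaining Kraus operators. -/
theorem exactlyReducible_of_contraction {ψ : Ket d} {φ : Ket d'} (hψ : ‖ψ‖ = 1) (hφ : ‖φ‖ = 1)
    {A : ∀ i, Matrix (Fin (d' i)) (Fin (d i)) ℂ} (hA : ∀ i, IsContraction (A i))
    (h : conjMap (tensorOp A) (proj ψ) = proj φ) : ExactlyReducible φ ψ := by
  -- A unit vector exists only if all local dimensions are positive.
  have hd' : ∀ i, 0 < d' i := by
    have hφ0 : φ ≠ 0 := by rintro rfl; simp at hφ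
    obtain ⟨x, -⟩ : ∃ x, φ x ≠ 0 := by
      by_contra! hx
      exact hφ0 (by ext x; simpa using hx x)
    exact fun i => (x i).pos
  obtain ⟨P, hP⟩ := exists_protocol_dominating hd' Finset.univ A hA
    fun i hi => absurd (Finset.mem_univ i) hi
  refine ⟨P, ?_⟩
  have hdom := hP (proj ψ) (proj_posSemidef ψ)
  rw [h] at hdom
  rw [← sub_eq_zero, ← hdom.trace_eq_zero_iff, Matrix.trace_sub, P.trace_superop, trace_proj,
    trace_proj, hψ, hφ, sub_self]

end LocalUnitary

end MultiLOCC

theorem corollary1 {ι : Type*} [Fintype ι] [DecidableEq ι] (d d' : ι → ℕ)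
    (ψ : MultiLOCC.Ket d) (φ : MultiLOCC.Ket d') (hψ : ‖ψ‖ = 1) (hφ : ‖φ‖ = 1) :
    MultiLOCC.LOCCEquiv ψ φ ↔ MultiLOCC.LUEquiv ψ φ := by
  open MultiLOCC in
  constructor
  · rintro ⟨⟨P, hP⟩, ⟨Q, hQ⟩⟩
    have h₁ := redNorm_le_and_exists_contraction hφ P ψ 1 (by simpa using hP)
    have h₂ := redNorm_le_and_exists_contraction hψ Q φ 1 (by simpa using hQ)
    have hψ0 : ψ ≠ 0 := by rintro rfl; simp at hψ
    obtain ⟨C, hC, h⟩ := h₁.2 hψ0 fun j =>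
      le_antisymm (h₁.1 j) (by simpa using h₂.1 j)
    exact luEquiv_of_contraction hψ hφ hC (by simpa using h)
  · intro h
    obtain ⟨A, hA, hAψ⟩ := h.exists_contraction
    obtain ⟨B, hB, hBφ⟩ := h.symm.exists_contraction
    exact ⟨exactlyReducible_of_contraction hψ hφ hA hAψ,
      exactlyReducible_of_contraction hφ hψ hB hBφ⟩
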